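/- Let $(\widehat M,\widehat g)$ be a semi-Riemannian manifold (without boundary), let $F:\widehat M\to\mathbb R$ be a smooth function, and let $(M,g)$ be the Monge-type hypersurface generated by $(\widehat M,\widehat g,F)$, that is, the hypersurface $M=\{(t,p)\in\overline M : t=F(p)\}$, with the induced metric, of the ambient semi-Riemannian manifold $\overline M=\mathbb R\times\widehat M$, $\overline g=-dx^0\otimes dx^0+\pi^*\widehat g$, where $x^0$ is the coordinate on $\mathbb R$ and $\pi:\overline M\to\widehat M$ is the projection. Let $\overline\nabla$ and $\widehat\nabla$ be the Levi-Civita connections of $\overline g$ and $\widehat g$. Call $M$ totally geodesic if, for every local section $\xi$ of the normal bundle $TM^\perp$, the second fundamental form $B_\xi(X,Y)=\overline g(\overline\nabla_XY,\xi)$ vanishes identically for all local sections $X,Y$ of $TM$. Let $\mathrm{Hess}(F)(X,Y)=X(YF)-(\widehat\nabla_XY)F$ be the Hessian of $F$ with respect to $\widehat g$. Then $M$ is totally geodesic if and only if $\mathrm{Hess}(F)\equiv 0$ on $\widehat M$. -/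

import Mathlib

open scoped Manifold ContDiff Topology

noncomputable section

open Bundle NormedSpace FiberBundle

section Metric

variable {E : Type*} [NormedAddCommGroup E] [NormedSpace ℝ E]
  {H : Type*} [TopologicalSpace H]

/-- A semi-Riemannian metric on `M`: a smooth, symmetric, nondegenerate `(0,2)`-tensor field. -/
structure SemiRiemannianMetric (I : ModelWithCorners ℝ E H) (M : Type*) [TopologicalSpace M]
    [ChartedSpace H M] [IsManifold I ∞ M] where
  /-- The scalar product on each tangent space. -/
  val (x : M) : TangentSpace I x →L[ℝ] TangentSpace I x →L[ℝ] ℝ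
  symm (x : M) (u v : TangentSpace I x) : val x u v = val x v u
  nondegenerate (x : M) (u : TangentSpace I x) : (∀ v, val x u v = 0) → u = 0
  contMDiff : ContMDiff I (I.prod 𝓘(ℝ, E →L[ℝ] E →L[ℝ] ℝ)) ∞
    (fun x ↦ TotalSpace.mk' (E →L[ℝ] E →L[ℝ] ℝ) x (val x))

namespace SemiRiemannianMetric

variable {I : ModelWithCorners ℝ E H} {M : Type*} [TopologicalSpace M]
  [ChartedSpace H M] [IsManifold I ∞ M] (g : SemiRiemannianMetric I M)

instance (x : M) [FiniteDimensional ℝ E] : FiniteDimensional ℝ (TangentSpace I x) :=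
  inferInstanceAs (FiniteDimensional ℝ E)

instance (x : M) : T2Space (TangentSpace I x) :=
  inferInstanceAs (T2Space E)

/-- The scalar product of two vector fields that are differentiable at `x` is differentiable
at `x`. -/
lemma mdifferentiableAt {X Y : Π x : M, TangentSpace I x} {x : M}
    (hX : MDiffAt (T% X) x) (hY : MDiffAt (T% Y) x) :
    MDiffAt (fun y ↦ g.val y (X y) (Y y)) x := by
  have h : MDifferentiableAt I (I.prod 𝓘(ℝ))
      (fun m ↦ TotalSpace.mk' ℝ (E := Bundle.Trivial M ℝ) m (g.val m (X m) (Y m))) x := by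
    apply MDifferentiableAt.clm_bundle_apply₂ (F₁ := E) (F₂ := E)
    · exact g.contMDiff.contMDiffAt.mdifferentiableAt (by simp)
    · exact hX
    · exact hY
  rw [mdifferentiableAt_totalSpace] at h
  exact h.2

/-- The Koszul expression, that is, the right-hand side of the Koszul formula for
`2 g(∇_X Y, Z)`. -/
def koszul (X Y Z : Π x : M, TangentSpace I x) (x : M) : ℝ :=
  d% (fun y ↦ g.val y (Y y) (Z y)) x (X x) + d% (fun y ↦ g.val y (Z y) (X y)) x (Y x)
    - d% (fun y ↦ g.val y (X y) (Y y)) x (Z x)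
    + g.val x (VectorField.mlieBracket I X Y x) (Z x)
    - g.val x (VectorField.mlieBracket I X Z x) (Y x)
    - g.val x (VectorField.mlieBracket I Y Z x) (X x)

lemma ext_val {x : M} {u u' : TangentSpace I x} (h : ∀ v, g.val x u v = g.val x u' v) :
    u = u' := by
  rw [← sub_eq_zero]
  exact g.nondegenerate x _ fun v ↦ by simp [h v]

/-- The function `Y F = dF(Y)` is differentiable where `Y` is. -/
lemma mdifferentiableAt_mvfderiv (F : C^∞⟮I, M; 𝓘(ℝ, ℝ), ℝ⟯) {Y : Π x : M, TangentSpace I x}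
    {x : M} (hY : MDiffAt (T% Y) x) : MDiffAt (fun y ↦ d% F y (Y y)) x := by
  have h1 : ContMDiff I.tangent 𝓘(ℝ, ℝ).tangent 1 (tangentMap I 𝓘(ℝ, ℝ) F) :=
    F.contMDiff.contMDiff_tangentMap (by norm_num; exact WithTop.coe_le_coe.mpr le_top)
  have h2 : ContMDiff 𝓘(ℝ, ℝ).tangent 𝓘(ℝ, ℝ) 1 (fun p : TangentBundle 𝓘(ℝ, ℝ) ℝ ↦ p.2) :=
    contMDiff_snd_tangentBundle_modelSpace ℝ 𝓘(ℝ, ℝ)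
  exact ((h2.comp h1).mdifferentiable one_ne_zero _).comp x hY

variable [FiniteDimensional ℝ E]

/-- The musical isomorphism `T_x M ≃ T_x^* M`, `u ↦ g(u, ·)`. -/
def flat (x : M) : TangentSpace I x ≃L[ℝ] (TangentSpace I x →L[ℝ] ℝ) :=
  (LinearEquiv.ofInjectiveOfFinrankEq (g.val x).toLinearMap
    (by
      rw [injective_iff_map_eq_zero]
      intro u hu
      exact g.nondegenerate x u fun v ↦ by
        have := congrArg (fun f : TangentSpace I x →L[ℝ] ℝ ↦ f v) hu
        simpa using this)
    (by
      rw [← (LinearMap.toContinuousLinearMap (𝕜 := ℝ) (E := TangentSpace I x)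
        (F' := ℝ)).finrank_eq]
      exact (Subspace.dual_finrank_eq).symm)).toContinuousLinearEquiv

@[simp] lemma flat_apply (x : M) (u v : TangentSpace I x) : g.flat x u v = g.val x u v := by
  rfl

@[simp] lemma val_flat_symm (x : M) (f : TangentSpace I x →L[ℝ] ℝ) (v : TangentSpace I x) :
    g.val x ((g.flat x).symm f) v = f v := by
  rw [← flat_apply, ContinuousLinearEquiv.apply_symm_apply]

lemma koszul_tensorial_left {Y Z : Π x : M, TangentSpace I x} {x : M}
    (hY : MDiffAt (T% Y) x) (hZ : MDiffAt (T% Z) x) :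
    TensorialAt I E (fun X ↦ g.koszul X Y Z x) x where
  smul {f X} hf hX := by
    have h1 : (fun y ↦ g.val y (Z y) ((f • X) y)) = fun y ↦ f y * g.val y (Z y) (X y) := by
      ext y; simp
    have h2 : (fun y ↦ g.val y ((f • X) y) (Y y)) = fun y ↦ f y * g.val y (X y) (Y y) := by
      ext y; simp
    simp only [koszul, h1, h2]
    rw [mvfderiv_fun_mul hf (g.mdifferentiableAt hZ hX),
      mvfderiv_fun_mul hf (g.mdifferentiableAt hX hY),
      VectorField.mlieBracket_smul_left hf hX, VectorField.mlieBracket_smul_left hf hX]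
    simp [g.symm x (Z x) (X x)]
    ring
  add {X X'} hX hX' := by
    have h1 : (fun y ↦ g.val y (Z y) ((X + X') y))
        = fun y ↦ g.val y (Z y) (X y) + g.val y (Z y) (X' y) := by
      ext y; simp
    have h2 : (fun y ↦ g.val y ((X + X') y) (Y y))
        = fun y ↦ g.val y (X y) (Y y) + g.val y (X' y) (Y y) := by
      ext y; simp
    simp only [koszul, h1, h2]
    rw [mvfderiv_fun_add (g.mdifferentiableAt hZ hX) (g.mdifferentiableAt hZ hX'),
      mvfderiv_fun_add (g.mdifferentiableAt hX hY) (g.mdifferentiableAt hX' hY),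
      VectorField.mlieBracket_add_left hX hX', VectorField.mlieBracket_add_left hX hX']
    simp
    ring

lemma koszul_tensorial_right {X Y : Π x : M, TangentSpace I x} {x : M}
    (hX : MDiffAt (T% X) x) (hY : MDiffAt (T% Y) x) :
    TensorialAt I E (fun Z ↦ g.koszul X Y Z x) x where
  smul {f Z} hf hZ := by
    have h1 : (fun y ↦ g.val y ((f • Z) y) (X y)) = fun y ↦ f y * g.val y (Z y) (X y) := by
      ext y; simp
    have h2 : (fun y ↦ g.val y (Y y) ((f • Z) y)) = fun y ↦ f y * g.val y (Y y) (Z y) := by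
      ext y; simp
    simp only [koszul, h1, h2]
    rw [mvfderiv_fun_mul hf (g.mdifferentiableAt hZ hX),
      mvfderiv_fun_mul hf (g.mdifferentiableAt hY hZ),
      VectorField.mlieBracket_smul_right hf hZ, VectorField.mlieBracket_smul_right hf hZ]
    simp [g.symm x (Z x) (X x), g.symm x (Z x) (Y x)]
    ring
  add {Z Z'} hZ hZ' := by
    have h1 : (fun y ↦ g.val y ((Z + Z') y) (X y))
        = fun y ↦ g.val y (Z y) (X y) + g.val y (Z' y) (X y) := by
      ext y; simp
    have h2 : (fun y ↦ g.val y (Y y) ((Z + Z') y))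
        = fun y ↦ g.val y (Y y) (Z y) + g.val y (Y y) (Z' y) := by
      ext y; simp
    simp only [koszul, h1, h2]
    rw [mvfderiv_fun_add (g.mdifferentiableAt hZ hX) (g.mdifferentiableAt hZ' hX),
      mvfderiv_fun_add (g.mdifferentiableAt hY hZ) (g.mdifferentiableAt hY hZ'),
      VectorField.mlieBracket_add_right hZ hZ', VectorField.mlieBracket_add_right hZ hZ']
    simp
    ring

open Classical in
/-- The value at `x` of the Levi-Civita connection on a field `Y`: for `Y` differentiable at `x`,
`∇_u Y` is the vector determined by the Koszul formula `2 g(∇_u Y, Z) = koszul u Y Z`. -/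
def leviCivitaAux (Y : Π x : M, TangentSpace I x) (x : M) :
    TangentSpace I x →L[ℝ] TangentSpace I x :=
  if hY : MDiffAt (T% Y) x then
    (g.flat x).symm.toContinuousLinearMap ∘L
      ((1 / 2 : ℝ) • TensorialAt.mkHom₂ (I := I) (F := E) (F' := E)
        (fun X Z ↦ g.koszul X Y Z x) x
        (fun _ hZ ↦ g.koszul_tensorial_left hY hZ) (fun _ hX ↦ g.koszul_tensorial_right hX hY))
  else 0

lemma val_leviCivitaAux {X Y Z : Π x : M, TangentSpace I x} {x : M}
    (hX : MDiffAt (T% X) x) (hY : MDiffAt (T% Y) x) (hZ : MDiffAt (T% Z) x) :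
    g.val x (g.leviCivitaAux Y x (X x)) (Z x) = 1 / 2 * g.koszul X Y Z x := by
  rw [leviCivitaAux, dif_pos hY]
  have := TensorialAt.mkHom₂_apply (I := I) (F := E) (F' := E)
    (Φ := fun X Z ↦ g.koszul X Y Z x) (x := x)
    (fun _ hZ ↦ g.koszul_tensorial_left hY hZ) (fun _ hX ↦ g.koszul_tensorial_right hX hY) hX hZ
  simp [this]

/-- Two vectors are equal as soon as their products with all values of differentiable fields
agree. -/
lemma ext_field {x : M} {A B : TangentSpace I x →L[ℝ] TangentSpace I x}
    (h : ∀ X Z : Π x : M, TangentSpace I x, MDiffAt (T% X) x → MDiffAt (T% Z) x →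
      g.val x (A (X x)) (Z x) = g.val x (B (X x)) (Z x)) : A = B := by
  ext u
  refine g.ext_val fun v ↦ ?_
  simpa using h (extend E u) (extend E v) (mdifferentiableAt_extend ..)
    (mdifferentiableAt_extend ..)

/-- The Levi-Civita connection of `g`, defined by the Koszul formula. In `g.leviCivita Y x u` the
differentiated field comes first: on paper this is `(∇_u Y)(x)`. -/
def leviCivita : CovariantDerivative I E (TangentSpace I : M → Type _) where
  toFun := g.leviCivitaAux
  isCovariantDerivativeOnUniv :=
    { add := by
        intro Y Y' x hY hY' _
        refine g.ext_field fun X Z hX hZ ↦ ?_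
        have hYY' : MDiffAt (T% (Y + Y')) x := mdifferentiableAt_add_section hY hY'
        rw [g.val_leviCivitaAux hX hYY' hZ]
        simp only [_root_.add_apply, map_add]
        rw [g.val_leviCivitaAux hX hY hZ, g.val_leviCivitaAux hX hY' hZ]
        have h1 : (fun y ↦ g.val y ((Y + Y') y) (Z y))
            = fun y ↦ g.val y (Y y) (Z y) + g.val y (Y' y) (Z y) := by
          ext y; simp
        have h2 : (fun y ↦ g.val y (X y) ((Y + Y') y))
            = fun y ↦ g.val y (X y) (Y y) + g.val y (X y) (Y' y) := by
          ext y; simp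
        simp only [koszul, h1, h2]
        rw [mvfderiv_fun_add (g.mdifferentiableAt hY hZ) (g.mdifferentiableAt hY' hZ),
          mvfderiv_fun_add (g.mdifferentiableAt hX hY) (g.mdifferentiableAt hX hY'),
          VectorField.mlieBracket_add_right hY hY', VectorField.mlieBracket_add_left hY hY']
        simp
        ring
      leibniz := by
        intro Y f x hY hf _
        refine g.ext_field fun X Z hX hZ ↦ ?_
        have hfY : MDiffAt (T% (f • Y)) x := MDifferentiableAt.smul_section hf hY
        rw [g.val_leviCivitaAux hX hfY hZ]
        simp only [_root_.add_apply, map_add, _root_.smul_apply, map_smul,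
          ContinuousLinearMap.smulRight_apply, smul_eq_mul]
        rw [g.val_leviCivitaAux hX hY hZ]
        have h1 : (fun y ↦ g.val y ((f • Y) y) (Z y))
            = fun y ↦ f y * g.val y (Y y) (Z y) := by
          ext y; simp
        have h2 : (fun y ↦ g.val y (X y) ((f • Y) y))
            = fun y ↦ f y * g.val y (X y) (Y y) := by
          ext y; simp
        simp only [koszul, h1, h2]
        rw [mvfderiv_fun_mul hf (g.mdifferentiableAt hY hZ),
          mvfderiv_fun_mul hf (g.mdifferentiableAt hX hY),
          VectorField.mlieBracket_smul_right hf hY, VectorField.mlieBracket_smul_left hf hY]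
        simp [g.symm x (Y x) (X x)]
        ring }

/-- The Koszul formula. -/
lemma koszul_formula {X Y Z : Π x : M, TangentSpace I x} {x : M}
    (hX : MDiffAt (T% X) x) (hY : MDiffAt (T% Y) x) (hZ : MDiffAt (T% Z) x) :
    2 * g.val x (g.leviCivita Y x (X x)) (Z x) = g.koszul X Y Z x := by
  rw [show g.leviCivita Y x = g.leviCivitaAux Y x from rfl, g.val_leviCivitaAux hX hY hZ]
  ring

/-- The Levi-Civita connection is torsion-free. -/
lemma leviCivita_torsion : g.leviCivita.torsion = 0 := by
  rw [CovariantDerivative.torsion_eq_zero_iff]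
  intro X Y x hX hY
  refine g.ext_val fun v ↦ ?_
  have hZ : MDiffAt (T% (extend E v)) x := mdifferentiableAt_extend ..
  have e1 := g.koszul_formula hX hY hZ
  have e2 := g.koszul_formula hY hX hZ
  simp only [extend_apply_self, koszul] at e1 e2
  have s1 : (fun y ↦ g.val y (X y) (Y y)) = fun y ↦ g.val y (Y y) (X y) := by
    ext y; exact g.symm ..
  have s2 : (fun y ↦ g.val y (X y) (extend E v y)) = fun y ↦ g.val y (extend E v y) (X y) := by
    ext y; exact g.symm ..
  have s3 : (fun y ↦ g.val y (Y y) (extend E v y)) = fun y ↦ g.val y (extend E v y) (Y y) := by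
    ext y; exact g.symm ..
  rw [s1, s3] at e1
  rw [s2, VectorField.mlieBracket_swap_apply] at e2
  simp only [map_neg, _root_.neg_apply] at e2
  simp only [map_sub, _root_.sub_apply]
  linarith

/-- The Levi-Civita connection is compatible with the metric. -/
lemma leviCivita_metric {X Y Z : Π x : M, TangentSpace I x} {x : M}
    (hX : MDiffAt (T% X) x) (hY : MDiffAt (T% Y) x) (hZ : MDiffAt (T% Z) x) :
    d% (fun y ↦ g.val y (Y y) (Z y)) x (X x) =
      g.val x (g.leviCivita Y x (X x)) (Z x) + g.val x (Y x) (g.leviCivita Z x (X x)) := by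
  have e1 := g.koszul_formula hX hY hZ
  have e2 := g.koszul_formula hX hZ hY
  simp only [koszul] at e1 e2
  have s1 : (fun y ↦ g.val y (X y) (Y y)) = fun y ↦ g.val y (Y y) (X y) := by
    ext y; exact g.symm ..
  have s2 : (fun y ↦ g.val y (X y) (Z y)) = fun y ↦ g.val y (Z y) (X y) := by
    ext y; exact g.symm ..
  have s3 : (fun y ↦ g.val y (Y y) (Z y)) = fun y ↦ g.val y (Z y) (Y y) := by
    ext y; exact g.symm ..
  rw [s1, s3] at e1
  rw [s2, VectorField.mlieBracket_swap_apply (V := Z)] at e2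
  simp only [map_neg, _root_.neg_apply] at e2
  rw [s3, g.symm x (Y x)]
  linarith

/-- The expression `X(Y F) - (∇_X Y) F`. -/
def hessianAux (F : C^∞⟮I, M; 𝓘(ℝ, ℝ), ℝ⟯) (x : M) (X Y : Π x : M, TangentSpace I x) : ℝ :=
  d% (fun y ↦ d% F y (Y y)) x (X x) - d% F x (g.leviCivita Y x (X x))

lemma hessianAux_tensorial_left (F : C^∞⟮I, M; 𝓘(ℝ, ℝ), ℝ⟯) (x : M)
    (Y : Π x : M, TangentSpace I x) :
    TensorialAt I E (fun X ↦ g.hessianAux F x X Y) x where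
  smul _ _ := by simp [hessianAux, mul_sub]
  add _ _ := by simp [hessianAux]; ring

lemma hessianAux_tensorial_right (F : C^∞⟮I, M; 𝓘(ℝ, ℝ), ℝ⟯) (x : M)
    (X : Π x : M, TangentSpace I x) :
    TensorialAt I E (fun Y ↦ g.hessianAux F x X Y) x where
  smul {f Y} hf hY := by
    have h : (fun y ↦ d% F y ((f • Y) y)) = fun y ↦ f y * d% F y (Y y) := by
      ext y; simp
    simp only [hessianAux, h]
    rw [mvfderiv_fun_mul hf (mdifferentiableAt_mvfderiv F hY),
      g.leviCivita.isCovariantDerivativeOn.leibniz hY hf]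
    simp
    ring
  add {Y Y'} hY hY' := by
    have h : (fun y ↦ d% F y ((Y + Y') y)) = fun y ↦ d% F y (Y y) + d% F y (Y' y) := by
      ext y; simp
    simp only [hessianAux, h]
    rw [mvfderiv_fun_add (mdifferentiableAt_mvfderiv F hY) (mdifferentiableAt_mvfderiv F hY'),
      g.leviCivita.isCovariantDerivativeOn.add hY hY']
    simp
    ring

/-- The Hessian of `F`: the `(0,2)`-tensor field `Hess(F)(X, Y) = X(Y F) - (∇_X Y) F`. -/
def hessian (F : C^∞⟮I, M; 𝓘(ℝ, ℝ), ℝ⟯) (x : M) :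
    TangentSpace I x →L[ℝ] TangentSpace I x →L[ℝ] ℝ :=
  TensorialAt.mkHom₂ (I := I) (F := E) (F' := E) (g.hessianAux F x) x
    (fun Y _ ↦ g.hessianAux_tensorial_left F x Y) (fun X _ ↦ g.hessianAux_tensorial_right F x X)

lemma hessian_apply (F : C^∞⟮I, M; 𝓘(ℝ, ℝ), ℝ⟯) {x : M} {X Y : Π x : M, TangentSpace I x}
    (hX : MDiffAt (T% X) x) (hY : MDiffAt (T% Y) x) :
    g.hessian F x (X x) (Y x) =
      d% (fun y ↦ d% F y (Y y)) x (X x) - d% F x (g.leviCivita Y x (X x)) :=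
  TensorialAt.mkHom₂_apply (I := I) (F := E) (F' := E) _ _ hX hY

end SemiRiemannianMetric

end Metric

section Hypersurface

variable {E : Type*} [NormedAddCommGroup E] [NormedSpace ℝ E]
  {H : Type*} [TopologicalSpace H] {I : ModelWithCorners ℝ E H}
  {M : Type*} [TopologicalSpace M] [ChartedSpace H M]

variable (I) in
/-- The tangent vectors at `q` to a submanifold `S` of `M`: the velocities at `q` of the smooth
curves lying in `S`. -/
def tangentVectors (S : Set M) (q : M) : Set (TangentSpace I q) :=
  {v | ∃ γ : ℝ → M, ContMDiffAt 𝓘(ℝ, ℝ) I ∞ γ 0 ∧ (∀ᶠ t in 𝓝 0, γ t ∈ S) ∧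
    (⟨γ 0, mfderiv 𝓘(ℝ, ℝ) I γ 0 (1 : ℝ)⟩ : TangentBundle I M) = ⟨q, v⟩}

variable [IsManifold I ∞ M]

/-- The normal space `T_q S^⊥` of a submanifold `S`. -/
def SemiRiemannianMetric.normalVectors (g : SemiRiemannianMetric I M) (S : Set M) (q : M) :
    Set (TangentSpace I q) :=
  {u | ∀ v ∈ tangentVectors I S q, g.val q u v = 0}

variable [FiniteDimensional ℝ E]

/-- The second fundamental form `B_ξ(X, Y) = g(∇_X Y, ξ)` associated with a normal field `ξ`. -/
def SemiRiemannianMetric.secondFundamentalForm (g : SemiRiemannianMetric I M)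
    (ξ X Y : Π x : M, TangentSpace I x) (q : M) : ℝ :=
  g.val q (g.leviCivita Y q (X q)) (ξ q)

/-- A submanifold `S` is totally geodesic if `B_ξ ≡ 0` for all local sections `ξ` of the normal
bundle `TS^⊥`. Local sections of `TS^⊥` and of `TS` are represented by smooth vector fields on an
open set `U` of the ambient manifold that are normal, respectively tangent, to `S` along `S`. -/
def SemiRiemannianMetric.IsTotallyGeodesic (g : SemiRiemannianMetric I M) (S : Set M) : Prop :=
  ∀ (U : Set M) (ξ X Y : Π x : M, TangentSpace I x), IsOpen U →
    ContMDiffOn I I.tangent ∞ (T% ξ) U → ContMDiffOn I I.tangent ∞ (T% X) U →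
    ContMDiffOn I I.tangent ∞ (T% Y) U →
    (∀ q ∈ S ∩ U, ξ q ∈ g.normalVectors S q) →
    (∀ q ∈ S ∩ U, X q ∈ tangentVectors I S q) → (∀ q ∈ S ∩ U, Y q ∈ tangentVectors I S q) →
    ∀ q ∈ S ∩ U, g.secondFundamentalForm ξ X Y q = 0

end Hypersurface

section Monge

variable {E : Type*} [NormedAddCommGroup E] [NormedSpace ℝ E]
  {H : Type*} [TopologicalSpace H] {I : ModelWithCorners ℝ E H}
  {M : Type*} [TopologicalSpace M] [ChartedSpace H M] [IsManifold I ∞ M]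

/-- The bilinear form `-dx⁰ ⊗ dx⁰ + π^* g` at a point of `ℝ × M`. -/
def mongeAmbientForm (g : SemiRiemannianMetric I M) (q : ℝ × M) :
    TangentSpace (𝓘(ℝ, ℝ).prod I) q →L[ℝ] TangentSpace (𝓘(ℝ, ℝ).prod I) q →L[ℝ] ℝ :=
  letI dx₀ : TangentSpace (𝓘(ℝ, ℝ).prod I) q →L[ℝ] ℝ :=
    mvfderiv (𝓘(ℝ, ℝ).prod I) (Prod.fst : ℝ × M → ℝ) q;
  letI dpr : TangentSpace (𝓘(ℝ, ℝ).prod I) q →L[ℝ] TangentSpace I q.2 :=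
    mfderiv (𝓘(ℝ, ℝ).prod I) I (Prod.snd : ℝ × M → M) q;
  -(dx₀.smulRight dx₀) + (dpr.precomp ℝ).comp ((g.val q.2).comp dpr)

lemma mongeAmbientForm_apply (g : SemiRiemannianMetric I M) (q : ℝ × M) (u v : ℝ × E) :
    mongeAmbientForm g q u v = -(u.1 * v.1) + g.val q.2 u.2 v.2 := by
  have h1 : mvfderiv (𝓘(ℝ, ℝ).prod I) (Prod.fst : ℝ × M → ℝ) q
      = ContinuousLinearMap.fst ℝ ℝ E := by
    have := mfderiv_fst (I := 𝓘(ℝ, ℝ)) (I' := I) (x := q)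
    unfold mvfderiv
    erw [this]
    rfl
  have h2 : mfderiv (𝓘(ℝ, ℝ).prod I) I (Prod.snd : ℝ × M → M) q
      = ContinuousLinearMap.snd ℝ ℝ E := mfderiv_snd
  simp only [mongeAmbientForm, h1, h2]
  rfl

lemma mongeTrivialization_apply (q₀ q : ℝ × M) (hq : q.2 ∈ (chartAt H q₀.2).source)
    (u : ℝ × E) :
    (trivializationAt (ℝ × E) (TangentSpace (𝓘(ℝ, ℝ).prod I)) q₀).continuousLinearMapAt ℝ q u
      = (u.1, (trivializationAt E (TangentSpace I) q₀.2).continuousLinearMapAt ℝ q.2 u.2) := by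
  rw [TangentBundle.continuousLinearMapAt_trivializationAt (by simp [hq, chartAt_self_eq]),
    TangentBundle.continuousLinearMapAt_trivializationAt hq]
  have h : (extChartAt (𝓘(ℝ, ℝ).prod I) q₀ : ℝ × M → ℝ × E)
      = Prod.map (id : ℝ → ℝ) (extChartAt I q₀.2) := by
    rw [extChartAt_prod]; rfl
  have h2 := mfderiv_prodMap (I := 𝓘(ℝ, ℝ)) (I' := I) (J := 𝓘(ℝ, ℝ)) (J' := 𝓘(ℝ, E)) (p := q)
    (f := (id : ℝ → ℝ)) (g := extChartAt I q₀.2) mdifferentiableAt_id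
    (mdifferentiableAt_extChartAt hq)
  have h3 : MDifferentiableAt (𝓘(ℝ, ℝ).prod I) 𝓘(ℝ, ℝ × E) (extChartAt (𝓘(ℝ, ℝ).prod I) q₀) q :=
    mdifferentiableAt_extChartAt (by simp [hq, chartAt_self_eq])
  have h4 : MDifferentiableAt (𝓘(ℝ, ℝ).prod I) (𝓘(ℝ, ℝ).prod 𝓘(ℝ, E))
      (Prod.map (id : ℝ → ℝ) (extChartAt I q₀.2)) q :=
    mdifferentiableAt_id.prodMap (mdifferentiableAt_extChartAt hq)
  have h5 : mfderiv (𝓘(ℝ, ℝ).prod I) 𝓘(ℝ, ℝ × E) (extChartAt (𝓘(ℝ, ℝ).prod I) q₀) q =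
      mfderiv (𝓘(ℝ, ℝ).prod I) (𝓘(ℝ, ℝ).prod 𝓘(ℝ, E))
        (Prod.map (id : ℝ → ℝ) (extChartAt I q₀.2)) q := by
    rw [h] at h3 ⊢
    simp only [mfderiv, h3, h4]
    rfl
  rw [h5, h2]
  simp
  rfl

lemma mongeTrivialization_symm (q₀ q : ℝ × M) (hq : q.2 ∈ (chartAt H q₀.2).source)
    (w : ℝ × E) :
    (trivializationAt (ℝ × E) (TangentSpace (𝓘(ℝ, ℝ).prod I)) q₀).symm q w
      = (w.1, (trivializationAt E (TangentSpace I) q₀.2).symm q.2 w.2) := by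
  have hq' : q ∈ (trivializationAt (ℝ × E) (TangentSpace (𝓘(ℝ, ℝ).prod I)) q₀).baseSet := by
    simp [hq, chartAt_self_eq]
  have hq2 : q.2 ∈ (trivializationAt E (TangentSpace I) q₀.2).baseSet := by simpa using hq
  have h := mongeTrivialization_apply (I := I) q₀ q hq
    (w.1, (trivializationAt E (TangentSpace I) q₀.2).symm q.2 w.2)
  have h1 := (trivializationAt E (TangentSpace I) q₀.2).continuousLinearMapAt_symmL (R := ℝ) hq2 w.2
  have h2 := (trivializationAt (ℝ × E) (TangentSpace (𝓘(ℝ, ℝ).prod I)) q₀).symmL_continuousLinearMapAt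
    (R := ℝ) hq' (w.1, (trivializationAt E (TangentSpace I) q₀.2).symm q.2 w.2)
  rw [Trivialization.symmL_apply _ hq2] at h1
  erw [h, h1] at h2
  exact (Trivialization.symmL_apply _ hq' _).symm.trans h2

lemma mongeAmbientForm_contMDiff (g : SemiRiemannianMetric I M) :
    ContMDiff (𝓘(ℝ, ℝ).prod I) ((𝓘(ℝ, ℝ).prod I).prod 𝓘(ℝ, (ℝ × E) →L[ℝ] (ℝ × E) →L[ℝ] ℝ)) ∞
      (fun q ↦ TotalSpace.mk' ((ℝ × E) →L[ℝ] (ℝ × E) →L[ℝ] ℝ) q (mongeAmbientForm g q)) := by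
  intro q₀
  rw [contMDiffAt_hom_bundle]
  refine ⟨contMDiffAt_id, ?_⟩
  have hg := ((contMDiffAt_hom_bundle _ ).1 (g.contMDiff q₀.2)).2
  have hg2 := ContMDiffAt.comp (I := 𝓘(ℝ, ℝ).prod I) q₀ hg
    (contMDiffAt_snd (I := 𝓘(ℝ, ℝ)) (J := I) (p := q₀))
  have hlin : ContDiff ℝ ∞ (fun c : E →L[ℝ] E →L[ℝ] ℝ ↦
      (-((ContinuousLinearMap.fst ℝ ℝ E).smulRight (ContinuousLinearMap.fst ℝ ℝ E))
        + ((ContinuousLinearMap.compL ℝ (ℝ × E) E ℝ).flip (ContinuousLinearMap.snd ℝ ℝ E)).comp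
          (c.comp (ContinuousLinearMap.snd ℝ ℝ E)) :
        (ℝ × E) →L[ℝ] (ℝ × E) →L[ℝ] ℝ)) := by
    fun_prop
  refine (hlin.contDiffAt.contMDiffAt.comp q₀ hg2).congr_of_eventuallyEq ?_
  have hs : ∀ᶠ q : ℝ × M in 𝓝 q₀, q.2 ∈ (chartAt H q₀.2).source :=
    continuousAt_snd.eventually (chart_source_mem_nhds H q₀.2)
  filter_upwards [hs] with q hq
  have hq' : q ∈ (trivializationAt (ℝ × E) (TangentSpace (𝓘(ℝ, ℝ).prod I)) q₀).baseSet := by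
    simp [hq, chartAt_self_eq]
  have hq2 : q.2 ∈ (trivializationAt E (TangentSpace I) q₀.2).baseSet := by simpa using hq
  refine ContinuousLinearMap.ext fun v ↦ ContinuousLinearMap.ext fun w ↦ ?_
  have e1 := inCoordinates_apply_eq₂ (𝕜 := ℝ) (E₃ := fun _ : ℝ × M ↦ ℝ) (F₃ := ℝ)
    (ϕ := mongeAmbientForm g q) (v := v) (w := w) hq' hq' (by simp)
  have e2 := inCoordinates_apply_eq₂ (𝕜 := ℝ) (E₃ := fun _ : M ↦ ℝ) (F₃ := ℝ)
    (ϕ := g.val q.2) (v := v.2) (w := w.2) hq2 hq2 (by simp)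
  rw [mongeTrivialization_symm q₀ q hq, mongeTrivialization_symm q₀ q hq] at e1
  refine e1.trans ?_
  have e3 := mongeAmbientForm_apply g q
    (v.1, (trivializationAt E (TangentSpace I) q₀.2).symm q.2 v.2)
    (w.1, (trivializationAt E (TangentSpace I) q₀.2).symm q.2 w.2)
  have e4 : (trivializationAt ℝ (Bundle.Trivial (ℝ × M) ℝ) q₀).linearMapAt ℝ q = LinearMap.id :=
    Bundle.Trivial.linearMapAt_trivialization ..
  have e5 : (trivializationAt ℝ (Bundle.Trivial M ℝ) q₀.2).linearMapAt ℝ q.2 = LinearMap.id :=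
    Bundle.Trivial.linearMapAt_trivialization ..
  refine (congrArg (fun f : ℝ →ₗ[ℝ] ℝ ↦ f _) e4).trans (e3.trans ?_)
  exact congrArg (-(v.1 * w.1) + ·) (e2.trans (congrArg (fun f : ℝ →ₗ[ℝ] ℝ ↦ f _) e5)).symm

/-- The metric `-dx⁰ ⊗ dx⁰ + π^* g` on the ambient space `ℝ × M`. -/
def mongeAmbientMetric (g : SemiRiemannianMetric I M) :
    SemiRiemannianMetric (𝓘(ℝ, ℝ).prod I) (ℝ × M) where
  val := mongeAmbientForm g
  symm q u v := by
    refine (mongeAmbientForm_apply g q u v).trans (.trans ?_ (mongeAmbientForm_apply g q v u).symm)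
    exact congrArg₂ (· + ·) (congrArg _ (mul_comm _ _)) (g.symm _ _ _)
  nondegenerate q u h := by
    have h1 := (mongeAmbientForm_apply g q u ((1 : ℝ), (0 : E))).symm.trans (h _)
    have h2 (v : E) := (mongeAmbientForm_apply g q u ((0 : ℝ), v)).symm.trans (h _)
    have hu : u.1 = 0 := by
      have h3 : g.val q.2 u.2 (0 : E) = 0 := (g.val q.2 u.2).map_zero
      simpa [h3] using h1
    have hu2 : u.2 = (0 : E) := g.nondegenerate q.2 u.2 fun v ↦ by simpa using h2 v
    exact Prod.ext hu hu2
  contMDiff := mongeAmbientForm_contMDiff g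

/-- The underlying set of the Monge-type hypersurface `{(t, p) | t = F(p)}` in `ℝ × M`. -/
def mongeHypersurface (F : M → ℝ) : Set (ℝ × M) :=
  {q | q.1 = F q.2}

end Monge

end

/-! The hypersurface is the zero set of `f = t - F`, and its tangent spaces are the kernels of `df`.
If `Y` is tangent along it, then `Y f` vanishes on it, so `X (Y f) = 0` for tangent `X`, and the
definition of the Hessian leaves `df(∇_X Y) = -Hess(f)(X, Y)`. A normal vector `a ∂₀ + u` is
metrically dual to `-a df`, because pairing it with the tangent vectors `dF(v) ∂₀ + v` forces `u = a
grad F`. Hence `B_ξ(X, Y) = a Hess(f)(X, Y)`.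

The ambient metric is a product, so `t` has zero Hessian and `Hess(f)` is minus the pullback of
`Hess(F)` (`leviCivita_prodTangent`, `hessian_mongeDefining`). Together these give `B_ξ(X, Y) = -a
Hess(F)(v, w)`, where `v`, `w` are the `M`-components of `X`, `Y`
(`secondFundamentalForm_mongeHypersurface`). One direction is then immediate. For the other, the
normal field `∂₀ + grad F` has `a = 1`, and every pair `v`, `w` at a point lifts to local tangent
fields. -/

noncomputable section

open Bundle NormedSpace FiberBundle

/-! ### Tangent vectors to subsets, coordinate fields and curves -/

section General

variable {E : Type*} [NormedAddCommGroup E] [NormedSpace ℝ E]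
  {H : Type*} [TopologicalSpace H] {I : ModelWithCorners ℝ E H}
  {M : Type*} [TopologicalSpace M] [ChartedSpace H M]

/-- A function vanishing near `q` on a set `S` has zero derivative along `tangentVectors I S q`. -/
lemma mvfderiv_eq_zero_of_mem_tangentVectors {S : Set M} {q : M} {f : M → ℝ}
    (hf : MDiffAt f q) (h0 : ∀ᶠ y in 𝓝 q, y ∈ S → f y = 0) {v : TangentSpace I q}
    (hv : v ∈ tangentVectors I S q) : d% f q v = 0 := by
  obtain ⟨γ, hγ, hS, hq⟩ := hv
  obtain ⟨rfl, hq⟩ := (TotalSpace.mk.injEq ..).mp hq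
  obtain rfl := eq_of_heq hq
  have hγd : MDifferentiableAt 𝓘(ℝ, ℝ) I γ 0 := hγ.mdifferentiableAt (by simp)
  have hc : f ∘ γ =ᶠ[𝓝 0] fun _ ↦ (0 : ℝ) := by
    filter_upwards [hS, hγ.continuousAt.eventually h0] with t h1 h2 using h2 h1
  have h := mvfderiv_comp_apply (I := I) (I' := 𝓘(ℝ, ℝ)) (0 : ℝ) hf hγd (1 : ℝ)
  rw [← h]
  have h3 : mvfderiv 𝓘(ℝ, ℝ) (f ∘ γ) 0 = 0 := by
    have := hc.mfderiv_eq (I := 𝓘(ℝ, ℝ)) (I' := 𝓘(ℝ, ℝ))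
    rw [mvfderiv, this]
    exact mvfderiv_const (I := 𝓘(ℝ, ℝ)) (0 : ℝ)
  rw [h3]; rfl

variable [IsManifold I ∞ M]

lemma extend_eq_symmL {x y : M} (u : TangentSpace I x) :
    extend E u y = (trivializationAt E (TangentSpace I) x).symm y
      (trivializationAt E (TangentSpace I) x ⟨x, u⟩).2 :=
  rfl

/-- In the chart at `x`, the field `extend E u` has constant coefficients. -/
lemma mpullbackWithin_extend (x : M) (u : TangentSpace I x) {y : E}
    (hy : y ∈ (extChartAt I x).target) :
    VectorField.mpullbackWithin 𝓘(ℝ, E) I (extChartAt I x).symm (extend E u) (Set.range I) y =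
      (trivializationAt E (TangentSpace I) x ⟨x, u⟩).2 := by
  have hx : (extChartAt I x).symm y ∈ (chartAt H x).source := by
    rw [← extChartAt_source I]; exact (extChartAt I x).map_target hy
  have hb : (extChartAt I x).symm y ∈ (trivializationAt E (TangentSpace I) x).baseSet := by
    simpa using hx
  have h := TangentBundle.symmL_trivializationAt (I := I) hx
  rw [(extChartAt I x).right_inv hy] at h
  have hi := isInvertible_mfderivWithin_extChartAt_symm (I := I) hy
  rw [VectorField.mpullbackWithin_apply, extend_eq_symmL]
  generalize (trivializationAt E (TangentSpace I) x ⟨x, u⟩).2 = w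
  have hs : (trivializationAt E (TangentSpace I) x).symm ((extChartAt I x).symm y) w =
      mfderivWithin 𝓘(ℝ, E) I (extChartAt I x).symm (Set.range I) y w := by
    rw [← h]
    exact (Trivialization.symmL_apply _ hb _).symm
  rw [hs]
  obtain ⟨e, he⟩ := hi
  rw [← he, ContinuousLinearMap.inverse_equiv]
  exact e.symm_apply_apply w

/-- Coordinate fields commute. -/
lemma mlieBracket_extend (x : M) (u v : TangentSpace I x) :
    VectorField.mlieBracket I (extend E u) (extend E v) x = 0 := by
  have key (w : TangentSpace I x) :
      VectorField.mpullbackWithin 𝓘(ℝ, E) I (extChartAt I x).symm (extend E w) (Set.range I)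
        =ᶠ[𝓝[Set.range I] (extChartAt I x x)]
      fun _ ↦ (trivializationAt E (TangentSpace I) x ⟨x, w⟩).2 := by
    filter_upwards [extChartAt_target_mem_nhdsWithin x] with y hy
    exact mpullbackWithin_extend x w hy
  -- The bracket is computed in the chart at `x`, where both fields are constant near the base point
  -- by `key`.
  rw [← VectorField.mlieBracketWithin_univ, VectorField.mlieBracketWithin_apply,
    Set.preimage_univ, Set.univ_inter]
  have hmem : extChartAt I x x ∈ Set.range I := by simp
  have h := (key u).lieBracketWithin_vectorField_eq_of_mem (𝕜 := ℝ) (key v) hmem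
  have h0 : VectorField.lieBracketWithin ℝ
      (fun _ : E ↦ (trivializationAt E (TangentSpace I) x ⟨x, u⟩).2)
      (fun _ : E ↦ (trivializationAt E (TangentSpace I) x ⟨x, v⟩).2)
      (Set.range I) (extChartAt I x x) = 0 := by
    simp [VectorField.lieBracketWithin]
  erw [h, h0]
  exact map_zero _

/-- `Y F = dF(Y)` is smooth where `Y` is. -/
lemma contMDiffAt_mvfderiv_apply (F : C^∞⟮I, M; 𝓘(ℝ, ℝ), ℝ⟯) {Y : Π x : M, TangentSpace I x}
    {x : M} (hY : ContMDiffAt I I.tangent ∞ (T% Y) x) :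
    ContMDiffAt I 𝓘(ℝ, ℝ) ∞ (fun y ↦ d% F y (Y y)) x := by
  have h1 : ContMDiff I.tangent 𝓘(ℝ, ℝ).tangent ∞ (tangentMap I 𝓘(ℝ, ℝ) F) :=
    F.contMDiff.contMDiff_tangentMap (by simp)
  have h2 : ContMDiff 𝓘(ℝ, ℝ).tangent 𝓘(ℝ, ℝ) ∞ (fun p : TangentBundle 𝓘(ℝ, ℝ) ℝ ↦ p.2) :=
    contMDiff_snd_tangentBundle_modelSpace ℝ 𝓘(ℝ, ℝ)
  exact ((h2.comp h1) _).comp x hY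

/-- On a manifold without boundary every tangent vector is the velocity of a smooth curve. -/
lemma exists_curve [I.Boundaryless] (p : M) (w : TangentSpace I p) :
    ∃ γ : ℝ → M, ContMDiffAt 𝓘(ℝ, ℝ) I ∞ γ 0 ∧ γ 0 = p ∧
      (⟨γ 0, mfderiv 𝓘(ℝ, ℝ) I γ 0 (1 : ℝ)⟩ : TangentBundle I M) = ⟨p, w⟩ := by
  let u : E := w
  -- A straight line in the chart at `p`. The tangent space at `p` is identified with `E` through
  -- this same chart, so the velocity of its image is `u` unchanged.
  let c : ℝ → E := fun t ↦ extChartAt I p p + t • u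
  have hc0 : c 0 = extChartAt I p p := by simp [c]
  have hc : ContDiff ℝ ∞ c := by fun_prop
  have hcd : HasDerivAt c u 0 := by
    simpa [c] using ((hasDerivAt_id (0 : ℝ)).smul_const u).const_add (extChartAt I p p)
  have hs : ContMDiffAt 𝓘(ℝ, E) I ∞ (extChartAt I p).symm (c 0) := by
    rw [hc0]
    exact (contMDiffOn_extChartAt_symm p).contMDiffAt (extChartAt_target_mem_nhds p)
  have hγ0 : ((extChartAt I p).symm ∘ c) 0 = p := by simp [hc0]
  refine ⟨(extChartAt I p).symm ∘ c, hs.comp 0 hc.contMDiff.contMDiffAt, hγ0, ?_⟩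
  have h1 : mfderiv 𝓘(ℝ, ℝ) I ((extChartAt I p).symm ∘ c) 0 (1 : ℝ)
      = mfderiv 𝓘(ℝ, E) I (extChartAt I p).symm (c 0) (mfderiv 𝓘(ℝ, ℝ) 𝓘(ℝ, E) c 0 (1 : ℝ)) :=
    mfderiv_comp_apply _ (hs.mdifferentiableAt (by simp))
      (hc.contMDiff.contMDiffAt.mdifferentiableAt (by simp)) _
  have h2 : mfderiv 𝓘(ℝ, ℝ) 𝓘(ℝ, E) c 0 (1 : ℝ) = u := by
    rw [mfderiv_eq_fderiv]
    exact (fderiv_apply_one_eq_deriv (f := c)).trans hcd.deriv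
  have h3 : mfderiv 𝓘(ℝ, E) I (extChartAt I p).symm (extChartAt I p p)
      = ContinuousLinearMap.id ℝ E := by
    have h4 := mfderivWithin_range_extChartAt_symm (I := I) (x := p)
    rw [I.range_eq_univ, mfderivWithin_univ] at h4
    exact h4
  rw [h2] at h1
  have h5 : (mfderiv 𝓘(ℝ, ℝ) I ((extChartAt I p).symm ∘ c) 0 (1 : ℝ) : E) = u := by
    refine h1.trans ?_
    -- The type of the derivative depends on its base point, so the point is generalised before the
    -- equality is substituted; `h7` does the same for `γ 0 = p`.
    have h6 : ∀ y, y = extChartAt I p p → (mfderiv 𝓘(ℝ, E) I (extChartAt I p).symm y u : E) = u := by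
      rintro _ rfl
      rw [h3]; rfl
    exact h6 _ hc0
  have h7 : ∀ (x : M) (a : TangentSpace I x), x = p → (a : E) = u →
      (⟨x, a⟩ : TangentBundle I M) = ⟨p, w⟩ := by
    rintro x a rfl h
    exact congrArg _ h
  exact h7 _ _ hγ0 h5

end General
-- Smoothness of the gradient
section Gradient

namespace SemiRiemannianMetric

variable {E : Type*} [NormedAddCommGroup E] [NormedSpace ℝ E] [FiniteDimensional ℝ E]
  {H : Type*} [TopologicalSpace H] {I : ModelWithCorners ℝ E H}
  {M : Type*} [TopologicalSpace M] [ChartedSpace H M] [IsManifold I ∞ M]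
  (g : SemiRiemannianMetric I M)

/-- The gradient of a function with respect to a semi-Riemannian metric. -/
def gradient (F : C^∞⟮I, M; 𝓘(ℝ, ℝ), ℝ⟯) (x : M) : TangentSpace I x :=
  (g.flat x).symm (d% F x)

lemma val_gradient (F : C^∞⟮I, M; 𝓘(ℝ, ℝ), ℝ⟯) (x : M) (v : TangentSpace I x) :
    g.val x (g.gradient F x) v = d% F x v :=
  g.val_flat_symm x _ v

/-- In the trivialization at `x₀` the metric becomes an operator `A x`, the differential of `F` a
covector `B x`, and the gradient the solution `s x` of `A x (s x) = B x`. Nondegeneracy makes `A x`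
invertible, and inversion of operators is smooth, so `s = A⁻¹ B` is smooth. -/
lemma contMDiffAt_gradient (F : C^∞⟮I, M; 𝓘(ℝ, ℝ), ℝ⟯) (x₀ : M) :
    ContMDiffAt I I.tangent ∞ (T% (g.gradient F)) x₀ := by
  rw [contMDiffAt_section]
  have hA := ((contMDiffAt_hom_bundle _).1 (g.contMDiff x₀)).2
  set A : M → E →L[ℝ] E →L[ℝ] ℝ := fun x ↦ ContinuousLinearMap.inCoordinates E (TangentSpace I)
    (E →L[ℝ] ℝ) (fun x : M ↦ TangentSpace I x →L[ℝ] ℝ) x₀ x x₀ x (g.val x) with hAdef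
  replace hA : ContMDiffAt I 𝓘(ℝ, E →L[ℝ] E →L[ℝ] ℝ) ∞ A x₀ := hA
  have hB := ContMDiffAt.mfderiv_const (I := I) (I' := 𝓘(ℝ, ℝ)) (m := ∞) (n := ∞)
    (F.contMDiff x₀) (by simp)
  set B : M → E →L[ℝ] ℝ := inTangentCoordinates I 𝓘(ℝ, ℝ) id F (mfderiv I 𝓘(ℝ, ℝ) F) x₀
  set t := trivializationAt E (TangentSpace I) x₀ with ht
  set s : M → E := fun x ↦ (t ⟨x, g.gradient F x⟩).2 with hs
  have hAapply (x : M) (hx : x ∈ t.baseSet) (v w : E) :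
      A x v w = g.val x (t.symm x v) (t.symm x w) := by
    have e2 := inCoordinates_apply_eq₂ (𝕜 := ℝ) (E₃ := fun _ : M ↦ ℝ) (F₃ := ℝ)
      (ϕ := g.val x) (v := v) (w := w) hx hx (by simp)
    have e5 : (trivializationAt ℝ (Bundle.Trivial M ℝ) x₀).linearMapAt ℝ x = LinearMap.id :=
      Bundle.Trivial.linearMapAt_trivialization ..
    exact e2.trans (congrArg (fun f : ℝ →ₗ[ℝ] ℝ ↦ f _) e5)
  have hBapply (x : M) (hx : x ∈ t.baseSet) (w : E) : B x w = d% F x (t.symm x w) := by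
    have h1 : B x = ((trivializationAt ℝ (TangentSpace 𝓘(ℝ, ℝ)) (F x₀)).continuousLinearMapAt ℝ
        (F x)).comp ((mfderiv I 𝓘(ℝ, ℝ) F x).comp (t.symmL ℝ x)) := rfl
    have h2 := TangentBundle.continuousLinearMapAt_model_space (𝕜 := ℝ) (F x₀) (F x)
    have h3 : t.symmL ℝ x w = t.symm x w := Trivialization.symmL_apply _ hx w
    rw [← h3, h1, h2]
    rfl
  have hAs (x : M) (hx : x ∈ t.baseSet) : A x (s x) = B x := by
    ext w
    rw [hAapply x hx, hBapply x hx, hs, t.symm_apply_apply_mk hx, val_gradient]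
  have hAinj (x : M) (hx : x ∈ t.baseSet) : Function.Injective (A x) := by
    rw [injective_iff_map_eq_zero]
    intro v hv
    have h0 : t.symm x v = 0 := by
      refine g.nondegenerate x _ fun w ↦ ?_
      have := hAapply x hx v (t ⟨x, w⟩).2
      rw [hv, t.symm_apply_apply_mk hx] at this
      exact this.symm
    have h1 := t.continuousLinearMapAt_symmL (R := ℝ) hx v
    rw [Trivialization.symmL_apply _ hx, h0, map_zero] at h1
    exact h1.symm
  -- `E` and its dual have the same finite dimension, so injectivity suffices.
  have hAequiv (x : M) (hx : x ∈ t.baseSet) : ∃ e : E ≃L[ℝ] (E →L[ℝ] ℝ), (e : E →L[ℝ] E →L[ℝ] ℝ) = A x :=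
    ⟨(LinearEquiv.ofInjectiveOfFinrankEq (A x).toLinearMap (hAinj x hx)
      (by
        rw [← (LinearMap.toContinuousLinearMap (𝕜 := ℝ) (E := E) (F' := ℝ)).finrank_eq]
        exact (Subspace.dual_finrank_eq).symm)).toContinuousLinearEquiv, by ext; rfl⟩
  have hx₀ : x₀ ∈ t.baseSet := FiberBundle.mem_baseSet_trivializationAt' x₀
  have hinv : ContMDiffAt I 𝓘(ℝ, (E →L[ℝ] ℝ) →L[ℝ] E) ∞ (fun x ↦ (A x).inverse) x₀ := by
    obtain ⟨e, he⟩ := hAequiv x₀ hx₀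
    have h := contDiffAt_map_inverse (𝕜 := ℝ) (n := ∞) e
    rw [he] at h
    exact ContMDiffAt.comp x₀ h.contMDiffAt hA
  refine (hinv.clm_apply hB).congr_of_eventuallyEq ?_
  filter_upwards [t.open_baseSet.mem_nhds hx₀] with x hx
  obtain ⟨e, he⟩ := hAequiv x hx
  have := hAs x hx
  change s x = (A x).inverse (B x)
  rw [← this, ← he, ContinuousLinearMap.inverse_equiv]
  simp

end SemiRiemannianMetric

end Gradient
-- Connection and Hessian of the product metric on `ℝ × M`
section Product

variable {E : Type*} [NormedAddCommGroup E] [NormedSpace ℝ E]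
  {H : Type*} [TopologicalSpace H] {I : ModelWithCorners ℝ E H}
  {M : Type*} [TopologicalSpace M] [ChartedSpace H M]

/-- The tangent vector `a ∂₀ + u` to `ℝ × M`. -/
def prodTangent (q : ℝ × M) (a : ℝ) (u : TangentSpace I q.2) :
    TangentSpace (𝓘(ℝ, ℝ).prod I) q :=
  ((a, u) : ℝ × E)

lemma exists_prodTangent {q : ℝ × M} (w : TangentSpace (𝓘(ℝ, ℝ).prod I) q) :
    ∃ (a : ℝ) (u : TangentSpace I q.2), w = prodTangent q a u :=
  ⟨(show ℝ × E from w).1, (show ℝ × E from w).2, rfl⟩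

lemma mvfderiv_comp_snd {f : M → ℝ} {q : ℝ × M} (hf : MDiffAt f q.2) (a : ℝ)
    (u : TangentSpace I q.2) :
    mvfderiv (𝓘(ℝ, ℝ).prod I) (fun y : ℝ × M ↦ f y.2) q (prodTangent q a u) = d% f q.2 u := by
  have h := mvfderiv_comp_apply (I' := 𝓘(ℝ, ℝ).prod I) (I := I) (f := (Prod.snd : ℝ × M → M)) q hf
    mdifferentiableAt_snd (prodTangent q a u)
  refine h.trans (congrArg (d% f q.2) ?_)
  rw [mfderiv_snd]
  rfl

lemma mvfderiv_prodFst (q : ℝ × M) (a : ℝ) (u : TangentSpace I q.2) :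
    mvfderiv (𝓘(ℝ, ℝ).prod I) (Prod.fst : ℝ × M → ℝ) q (prodTangent q a u) = a := by
  have := mfderiv_fst (I := 𝓘(ℝ, ℝ)) (I' := I) (x := q)
  unfold mvfderiv
  erw [this]
  rfl

/-- The function `(t, p) ↦ t - F(p)` defining the Monge-type hypersurface of `F`. -/
def mongeDefining (F : C^∞⟮I, M; 𝓘(ℝ, ℝ), ℝ⟯) :
    C^∞⟮𝓘(ℝ, ℝ).prod I, ℝ × M; 𝓘(ℝ, ℝ), ℝ⟯ :=
  ⟨fun q ↦ q.1 - F q.2, contMDiff_fst.sub (F.contMDiff.comp contMDiff_snd)⟩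

lemma mvfderiv_mongeDefining (F : C^∞⟮I, M; 𝓘(ℝ, ℝ), ℝ⟯) (q : ℝ × M) (a : ℝ)
    (u : TangentSpace I q.2) :
    mvfderiv (𝓘(ℝ, ℝ).prod I) (mongeDefining F) q (prodTangent q a u) = a - d% F q.2 u := by
  have hF : MDiffAt F q.2 := F.contMDiff.mdifferentiable (by simp) _
  have h1 : MDifferentiableAt (𝓘(ℝ, ℝ).prod I) 𝓘(ℝ, ℝ) (Prod.fst : ℝ × M → ℝ) q :=
    mdifferentiableAt_fst
  have h2 : MDifferentiableAt (𝓘(ℝ, ℝ).prod I) 𝓘(ℝ, ℝ) (fun y : ℝ × M ↦ F y.2) q :=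
    hF.comp q mdifferentiableAt_snd
  have h := mvfderiv_sub h1 h2
  have hG : (mongeDefining F : ℝ × M → ℝ) = Prod.fst - fun y : ℝ × M ↦ F y.2 := rfl
  rw [hG, h, _root_.sub_apply, mvfderiv_prodFst, mvfderiv_comp_snd hF]

variable [IsManifold I ∞ M]

lemma mongeAmbientMetric_val (g : SemiRiemannianMetric I M) (q : ℝ × M) (a b : ℝ)
    (u v : TangentSpace I q.2) :
    (mongeAmbientMetric g).val q (prodTangent q a u) (prodTangent q b v) =
      -(a * b) + g.val q.2 u v :=
  mongeAmbientForm_apply g q (a, u) (b, v)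

/-- The chart of `ℝ × M` is the identity times a chart of `M`, so the trivialization respects the
splitting of tangent vectors. -/
lemma trivializationAt_prodTangent {q₀ q : ℝ × M} (hq : q.2 ∈ (chartAt H q₀.2).source) (a : ℝ)
    (u : TangentSpace I q.2) :
    (trivializationAt (ℝ × E) (TangentSpace (𝓘(ℝ, ℝ).prod I)) q₀ ⟨q, prodTangent q a u⟩).2 =
      (a, (trivializationAt E (TangentSpace I) q₀.2 ⟨q.2, u⟩).2) := by
  have h := mongeTrivialization_apply (I := I) q₀ q hq (a, u)
  have hq' : q ∈ (trivializationAt (ℝ × E) (TangentSpace (𝓘(ℝ, ℝ).prod I)) q₀).baseSet := by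
    simp [hq, chartAt_self_eq]
  have hq2 : q.2 ∈ (trivializationAt E (TangentSpace I) q₀.2).baseSet := by simpa using hq
  have h1 := congrFun (Trivialization.coe_linearMapAt_of_mem (R := ℝ) _ hq') (prodTangent q a u)
  have h2 := congrFun (Trivialization.coe_linearMapAt_of_mem (R := ℝ) _ hq2) u
  exact h1.symm.trans (h.trans (congrArg (Prod.mk a) h2))

lemma eventually_chart_snd (q₀ : ℝ × M) : ∀ᶠ q : ℝ × M in 𝓝 q₀, q.2 ∈ (chartAt H q₀.2).source :=
  continuousAt_snd.eventually (chart_source_mem_nhds H q₀.2)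

/-- Constant coefficients in a product chart mean constant coefficients in each factor. This reduces
computations with coordinate fields on `ℝ × M` to coordinate fields on `M`. -/
lemma extend_prodTangent (q₀ : ℝ × M) (a : ℝ) (u : TangentSpace I q₀.2) :
    ∀ᶠ q in 𝓝 q₀, extend (ℝ × E) (prodTangent q₀ a u) q = prodTangent q a (extend E u q.2) := by
  filter_upwards [eventually_chart_snd (H := H) q₀] with q hq
  have h := trivializationAt_prodTangent (I := I) (q₀ := q₀) (mem_chart_source H q₀.2) a u
  rw [extend_eq_symmL, h, mongeTrivialization_symm q₀ q hq]
  rfl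

/-- A field on `ℝ × M` is smooth if its component functions are. -/
lemma contMDiffAt_prodTangent {q₀ : ℝ × M} {a : ℝ × M → ℝ} {Y : Π x : M, TangentSpace I x}
    (ha : ContMDiffAt (𝓘(ℝ, ℝ).prod I) 𝓘(ℝ, ℝ) ∞ a q₀)
    (hY : ContMDiffAt I I.tangent ∞ (T% Y) q₀.2) :
    ContMDiffAt (𝓘(ℝ, ℝ).prod I) (𝓘(ℝ, ℝ).prod I).tangent ∞
      (fun q ↦ (⟨q, prodTangent q (a q) (Y q.2)⟩ : TangentBundle (𝓘(ℝ, ℝ).prod I) (ℝ × M))) q₀ := by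
  rw [contMDiffAt_section (IB := 𝓘(ℝ, ℝ).prod I) (F := ℝ × E)]
  rw [contMDiffAt_section] at hY
  have h := ha.prodMk_space (hY.comp q₀ (contMDiffAt_snd (I := 𝓘(ℝ, ℝ)) (J := I)))
  refine h.congr_of_eventuallyEq ?_
  filter_upwards [eventually_chart_snd (H := H) q₀] with q hq
  exact trivializationAt_prodTangent hq _ _

variable (g : SemiRiemannianMetric I M)

/-- Coordinate fields commute, so only the three derivative terms of the Koszul expression survive.
-/
lemma SemiRiemannianMetric.koszul_extend {x : M} (u v w : TangentSpace I x) :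
    g.koszul (extend E u) (extend E v) (extend E w) x =
      d% (fun y ↦ g.val y (extend E v y) (extend E w y)) x u
      + d% (fun y ↦ g.val y (extend E w y) (extend E u y)) x v
      - d% (fun y ↦ g.val y (extend E u y) (extend E v y)) x w := by
  simp [SemiRiemannianMetric.koszul, mlieBracket_extend]

/-- The `∂₀`-components contribute only the constant `-(b * c)`, and the remaining term does not
depend on `t`. -/
lemma mvfderiv_val_extend (q : ℝ × M) (a b c : ℝ) (u v w : TangentSpace I q.2) :
    mvfderiv (𝓘(ℝ, ℝ).prod I) (fun y ↦ (mongeAmbientMetric g).val y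
      (extend (ℝ × E) (prodTangent q b v) y) (extend (ℝ × E) (prodTangent q c w) y)) q
      (prodTangent q a u) = d% (fun y ↦ g.val y (extend E v y) (extend E w y)) q.2 u := by
  have h : MDiffAt (fun y ↦ g.val y (extend E v y) (extend E w y)) q.2 :=
    g.mdifferentiableAt (mdifferentiableAt_extend ..) (mdifferentiableAt_extend ..)
  have h' : MDiffAt (fun y ↦ -(b * c) + g.val y (extend E v y) (extend E w y)) q.2 :=
    mdifferentiableAt_const.add h
  have he : (fun y ↦ (mongeAmbientMetric g).val y
      (extend (ℝ × E) (prodTangent q b v) y) (extend (ℝ × E) (prodTangent q c w) y)) =ᶠ[𝓝 q]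
      fun y ↦ -(b * c) + g.val y.2 (extend E v y.2) (extend E w y.2) := by
    filter_upwards [extend_prodTangent q b v, extend_prodTangent q c w] with y h1 h2
    rw [h1, h2, mongeAmbientMetric_val]
  have e1 := he.mfderiv_eq (I := 𝓘(ℝ, ℝ).prod I) (I' := 𝓘(ℝ, ℝ))
  have e2 := mvfderiv_comp_snd h' a u
  have e3 := mvfderiv_fun_add (I := I) (mdifferentiableAt_const (c := -(b * c))) h
  rw [e3, mvfderiv_const, zero_add] at e2
  rw [← e2]
  exact congrArg (fun L : ℝ × E →L[ℝ] ℝ ↦ L (a, u)) e1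

variable [FiniteDimensional ℝ E]

/-- Tested against `c ∂₀ + w`, the ambient Koszul expression equals that of `g` tested against `w`.
It is independent of `c`, so the covariant derivative has no `∂₀`-component. -/
lemma leviCivita_prodTangent (q : ℝ × M) (a b : ℝ) (u v : TangentSpace I q.2) :
    (mongeAmbientMetric g).leviCivita (extend (ℝ × E) (prodTangent q b v)) q (prodTangent q a u) =
      prodTangent q 0 (g.leviCivita (extend E v) q.2 u) := by
  refine (mongeAmbientMetric g).ext_val fun z ↦ ?_
  obtain ⟨c, w, rfl⟩ := exists_prodTangent z
  have h1 := (mongeAmbientMetric g).koszul_formula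
    (mdifferentiableAt_extend (𝓘(ℝ, ℝ).prod I) (ℝ × E) (prodTangent q a u))
    (mdifferentiableAt_extend (𝓘(ℝ, ℝ).prod I) (ℝ × E) (prodTangent q b v))
    (mdifferentiableAt_extend (𝓘(ℝ, ℝ).prod I) (ℝ × E) (prodTangent q c w))
  have h2 := g.koszul_formula (mdifferentiableAt_extend I E u) (mdifferentiableAt_extend I E v)
    (mdifferentiableAt_extend I E w)
  rw [SemiRiemannianMetric.koszul_extend] at h1 h2
  rw [mvfderiv_val_extend, mvfderiv_val_extend, mvfderiv_val_extend, ← h2] at h1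
  rw [mongeAmbientMetric_val]
  simp only [extend_apply_self] at h1
  linarith

/-- The coordinate `t` contributes nothing: its derivative along the coordinate field is the
constant `b`, and `∇` has no `∂₀`-component. Only `-F` remains. -/
lemma hessian_mongeDefining (F : C^∞⟮I, M; 𝓘(ℝ, ℝ), ℝ⟯) (q : ℝ × M) (a b : ℝ)
    (u v : TangentSpace I q.2) :
    (mongeAmbientMetric g).hessian (mongeDefining F) q (prodTangent q a u) (prodTangent q b v) =
      -g.hessian F q.2 u v := by
  have h1 := (mongeAmbientMetric g).hessian_apply (mongeDefining F)
    (mdifferentiableAt_extend (𝓘(ℝ, ℝ).prod I) (ℝ × E) (prodTangent q a u))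
    (mdifferentiableAt_extend (𝓘(ℝ, ℝ).prod I) (ℝ × E) (prodTangent q b v))
  have h2 := g.hessian_apply F (mdifferentiableAt_extend I E u) (mdifferentiableAt_extend I E v)
  simp only [extend_apply_self] at h1 h2
  rw [leviCivita_prodTangent, mvfderiv_mongeDefining] at h1
  have h : MDiffAt (fun y ↦ d% F y (extend E v y)) q.2 :=
    SemiRiemannianMetric.mdifferentiableAt_mvfderiv F (mdifferentiableAt_extend I E v)
  have h' : MDiffAt (fun y ↦ b - d% F y (extend E v y)) q.2 := mdifferentiableAt_const.sub h
  have he : (fun y ↦ mvfderiv (𝓘(ℝ, ℝ).prod I) (mongeDefining F) y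
      (extend (ℝ × E) (prodTangent q b v) y)) =ᶠ[𝓝 q] fun y ↦ b - d% F y.2 (extend E v y.2) := by
    filter_upwards [extend_prodTangent q b v] with y h1
    rw [h1, mvfderiv_mongeDefining]
  have e1 := he.mfderiv_eq (I := 𝓘(ℝ, ℝ).prod I) (I' := 𝓘(ℝ, ℝ))
  have e2 := mvfderiv_comp_snd h' a u
  have e3 := mvfderiv_fun_sub (I := I) (mdifferentiableAt_const (c := b)) h
  rw [e3, mvfderiv_const, zero_sub] at e2
  have e4 : mvfderiv (𝓘(ℝ, ℝ).prod I) (fun y ↦ mvfderiv (𝓘(ℝ, ℝ).prod I) (mongeDefining F) y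
      (extend (ℝ × E) (prodTangent q b v) y)) q (prodTangent q a u)
      = -d% (fun y ↦ d% F y (extend E v y)) q.2 u := by
    refine Eq.trans ?_ e2
    exact congrArg (fun L : ℝ × E →L[ℝ] ℝ ↦ L (a, u)) e1
  rw [h1, h2, e4]
  ring

end Product
-- Tangent and normal spaces and the second fundamental form of the hypersurface
section MongeHypersurface

variable {E : Type*} [NormedAddCommGroup E] [NormedSpace ℝ E]
  {H : Type*} [TopologicalSpace H] {I : ModelWithCorners ℝ E H}
  {M : Type*} [TopologicalSpace M] [ChartedSpace H M]

lemma mvfderiv_mongeDefining_of_mem_tangentVectors (F : C^∞⟮I, M; 𝓘(ℝ, ℝ), ℝ⟯) {q : ℝ × M}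
    {v : TangentSpace (𝓘(ℝ, ℝ).prod I) q}
    (hv : v ∈ tangentVectors (𝓘(ℝ, ℝ).prod I) (mongeHypersurface F) q) :
    mvfderiv (𝓘(ℝ, ℝ).prod I) (mongeDefining F) q v = 0 :=
  mvfderiv_eq_zero_of_mem_tangentVectors ((mongeDefining F).contMDiff.mdifferentiable (by simp) _)
    (.of_forall fun _ hy ↦ sub_eq_zero.mpr hy) hv

variable [IsManifold I ∞ M]

/-- A curve `γ` in `M` with velocity `u` lifts to the curve `(F ∘ γ, γ)` in the graph. With
`mvfderiv_mongeDefining_of_mem_tangentVectors`, this identifies the tangent vectors at a point of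
the graph with the kernel of `d(t - F)`. -/
lemma prodTangent_mem_tangentVectors [I.Boundaryless] (F : C^∞⟮I, M; 𝓘(ℝ, ℝ), ℝ⟯) {q : ℝ × M}
    (hq : q ∈ mongeHypersurface F) (u : TangentSpace I q.2) :
    prodTangent q (d% F q.2 u) u ∈
      tangentVectors (𝓘(ℝ, ℝ).prod I) (mongeHypersurface F) q := by
  obtain ⟨t, p⟩ := q
  obtain rfl : t = F p := hq
  obtain ⟨γ, hγ, h0, h⟩ := exists_curve p u
  subst h0
  have hu : mfderiv 𝓘(ℝ, ℝ) I γ 0 (1 : ℝ) = u := eq_of_heq ((TotalSpace.mk.injEq ..).mp h).2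
  have hFγ : ContMDiffAt 𝓘(ℝ, ℝ) 𝓘(ℝ, ℝ) ∞ (F ∘ γ) 0 := (F.contMDiff _).comp 0 hγ
  refine ⟨fun s ↦ (F (γ s), γ s), hFγ.prodMk hγ, .of_forall fun _ ↦ rfl, ?_⟩
  have h1 := mfderiv_prodMk (hFγ.mdifferentiableAt (by simp)) (hγ.mdifferentiableAt (by simp))
  have h2 : mfderiv 𝓘(ℝ, ℝ) 𝓘(ℝ, ℝ) (F ∘ γ) 0 (1 : ℝ) = d% F (γ 0) u := by
    rw [← hu]
    exact mvfderiv_comp_apply (I := I) (I' := 𝓘(ℝ, ℝ)) (0 : ℝ)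
      (F.contMDiff.mdifferentiable (by simp) _) (hγ.mdifferentiableAt (by simp)) (1 : ℝ)
  refine congrArg (TotalSpace.mk _) ?_
  refine (congrArg (fun L : ℝ →L[ℝ] ℝ × E ↦ L 1) h1).trans ?_
  exact Prod.ext h2 hu

variable (g : SemiRiemannianMetric I M)

/-- The product with a normal vector `a ∂₀ + u` is `-a d(t - F)`. -/
lemma val_of_mem_normalVectors [I.Boundaryless] (F : C^∞⟮I, M; 𝓘(ℝ, ℝ), ℝ⟯) {q : ℝ × M}
    (hq : q ∈ mongeHypersurface F) {a : ℝ} {u : TangentSpace I q.2}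
    (h : prodTangent q a u ∈ (mongeAmbientMetric g).normalVectors (mongeHypersurface F) q)
    (z : TangentSpace (𝓘(ℝ, ℝ).prod I) q) :
    (mongeAmbientMetric g).val q (prodTangent q a u) z =
      -(a * mvfderiv (𝓘(ℝ, ℝ).prod I) (mongeDefining F) q z) := by
  obtain ⟨b, v, rfl⟩ := exists_prodTangent z
  -- Orthogonality to the tangent lift of `v` reads `g(u, v) = a dF(v)`.
  have h1 := h _ (prodTangent_mem_tangentVectors F hq v)
  rw [mongeAmbientMetric_val] at h1
  rw [mongeAmbientMetric_val, mvfderiv_mongeDefining]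
  linarith

variable [FiniteDimensional ℝ E]

/-- The vector `∂₀ + grad F` is the metric dual of `-d(t - F)`, the sign coming from `-dx⁰ ⊗ dx⁰`.
It provides a global normal field with `∂₀`-component `1`. -/
lemma gradient_mem_normalVectors (F : C^∞⟮I, M; 𝓘(ℝ, ℝ), ℝ⟯) (q : ℝ × M) :
    prodTangent q 1 (g.gradient F q.2) ∈
      (mongeAmbientMetric g).normalVectors (mongeHypersurface F) q := by
  intro v hv
  have h := mvfderiv_mongeDefining_of_mem_tangentVectors F hv
  obtain ⟨b, v, rfl⟩ := exists_prodTangent v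
  rw [mvfderiv_mongeDefining] at h
  rw [mongeAmbientMetric_val, g.val_gradient]
  linarith

/-- The second fundamental form of a Monge-type hypersurface is the restriction of a multiple of
the Hessian of `F`. -/
lemma secondFundamentalForm_mongeHypersurface [I.Boundaryless] (F : C^∞⟮I, M; 𝓘(ℝ, ℝ), ℝ⟯)
    {q : ℝ × M} (hq : q ∈ mongeHypersurface F)
    {ξ X Y : Π x : ℝ × M, TangentSpace (𝓘(ℝ, ℝ).prod I) x}
    (hX : MDifferentiableAt (𝓘(ℝ, ℝ).prod I) (𝓘(ℝ, ℝ).prod I).tangent (T% X) q)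
    (hY : MDifferentiableAt (𝓘(ℝ, ℝ).prod I) (𝓘(ℝ, ℝ).prod I).tangent (T% Y) q)
    (hXS : X q ∈ tangentVectors (𝓘(ℝ, ℝ).prod I) (mongeHypersurface F) q)
    (hYS : ∀ᶠ y in 𝓝 q, y ∈ mongeHypersurface F →
      Y y ∈ tangentVectors (𝓘(ℝ, ℝ).prod I) (mongeHypersurface F) y)
    (hξS : ξ q ∈ (mongeAmbientMetric g).normalVectors (mongeHypersurface F) q)
    {a b c : ℝ} {u v w : TangentSpace I q.2} (hξ : ξ q = prodTangent q a u)
    (hXq : X q = prodTangent q b v) (hYq : Y q = prodTangent q c w) :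
    (mongeAmbientMetric g).secondFundamentalForm ξ X Y q = -(a * g.hessian F q.2 v w) := by
  rw [hξ] at hξS
  have h1 := val_of_mem_normalVectors g F hq hξS
    ((mongeAmbientMetric g).leviCivita Y q (X q))
  have h2 := (mongeAmbientMetric g).hessian_apply (mongeDefining F) hX hY
  -- Near `q`, the function `Y(t - F)` vanishes on the hypersurface, so its derivative along the
  -- tangent vector `X q` is zero. Tangency of `Y` at `q` alone would not suffice.
  have h3 := mvfderiv_eq_zero_of_mem_tangentVectors
    (SemiRiemannianMetric.mdifferentiableAt_mvfderiv (mongeDefining F) hY)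
    (hYS.mono fun y h hy ↦ mvfderiv_mongeDefining_of_mem_tangentVectors F (h hy)) hXS
  have h4 := hessian_mongeDefining g F q b c v w
  rw [h3, zero_sub] at h2
  rw [← hXq, ← hYq, h2] at h4
  rw [SemiRiemannianMetric.secondFundamentalForm, SemiRiemannianMetric.symm, hξ, h1, neg_inj.mp h4]

end MongeHypersurface

end

/-! ### The equivalence -/

theorem mainTheorem6
    {E : Type*} [NormedAddCommGroup E] [NormedSpace ℝ E] [FiniteDimensional ℝ E]
    {H : Type*} [TopologicalSpace H] {I : ModelWithCorners ℝ E H} [I.Boundaryless]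
    {M : Type*} [TopologicalSpace M] [ChartedSpace H M] [IsManifold I ∞ M]
    (g : SemiRiemannianMetric I M) (F : C^∞⟮I, M; 𝓘(ℝ, ℝ), ℝ⟯) :
    (mongeAmbientMetric g).IsTotallyGeodesic (mongeHypersurface F) ↔
      ∀ p : M, g.hessian F p = 0 := by
  constructor
  · intro h p
    ext v w
    obtain ⟨s, hs, hvs⟩ := FiberBundle.exists_contMDiffOn_extend (k := ∞) I E v
    obtain ⟨s', hs', hws⟩ := FiberBundle.exists_contMDiffOn_extend (k := ∞) I E w
    -- The extensions of `v` and `w` are known to be smooth only near `p`; the cylinder over `V` is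
    -- the open set on which total geodesy is tested.
    obtain ⟨V, hV, hVo, hpV⟩ := mem_nhds_iff.mp (Filter.inter_mem hs hs')
    have hv (x : M) (hx : x ∈ V) : ContMDiffAt I I.tangent ∞ (T% (FiberBundle.extend E v)) x :=
      hvs.contMDiffAt (Filter.mem_of_superset (hVo.mem_nhds hx) fun _ hy ↦ (hV hy).1)
    have hw (x : M) (hx : x ∈ V) : ContMDiffAt I I.tangent ∞ (T% (FiberBundle.extend E w)) x :=
      hws.contMDiffAt (Filter.mem_of_superset (hVo.mem_nhds hx) fun _ hy ↦ (hV hy).2)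
    let ξ : Π x : ℝ × M, TangentSpace (𝓘(ℝ, ℝ).prod I) x :=
      fun q ↦ prodTangent q 1 (g.gradient F q.2)
    -- The lift of `Z` is constant in `t` and lies in the kernel of `d(t - F)` everywhere, so it is
    -- tangent along the graph.
    let L (Z : Π x : M, TangentSpace I x) : Π x : ℝ × M, TangentSpace (𝓘(ℝ, ℝ).prod I) x :=
      fun q ↦ prodTangent q (d% F q.2 (Z q.2)) (Z q.2)
    have hL {Z : Π x : M, TangentSpace I x} {q : ℝ × M}
        (hZ : ContMDiffAt I I.tangent ∞ (T% Z) q.2) :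
        ContMDiffAt (𝓘(ℝ, ℝ).prod I) (𝓘(ℝ, ℝ).prod I).tangent ∞ (T% (L Z)) q :=
      contMDiffAt_prodTangent ((contMDiffAt_mvfderiv_apply F hZ).comp q contMDiffAt_snd) hZ
    have hξ (q : ℝ × M) :
        ContMDiffAt (𝓘(ℝ, ℝ).prod I) (𝓘(ℝ, ℝ).prod I).tangent ∞ (T% ξ) q :=
      contMDiffAt_prodTangent contMDiffAt_const (g.contMDiffAt_gradient F q.2)
    have hLS (Z : Π x : M, TangentSpace I x) (q : ℝ × M) (hq : q ∈ mongeHypersurface F) :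
        L Z q ∈ tangentVectors (𝓘(ℝ, ℝ).prod I) (mongeHypersurface F) q :=
      prodTangent_mem_tangentVectors F hq _
    have hB := h (Prod.snd ⁻¹' V) ξ (L (FiberBundle.extend E v)) (L (FiberBundle.extend E w))
      (hVo.preimage continuous_snd) (fun q _ ↦ (hξ q).contMDiffWithinAt)
      (fun q hq ↦ (hL (hv _ hq)).contMDiffWithinAt) (fun q hq ↦ (hL (hw _ hq)).contMDiffWithinAt)
      (fun q _ ↦ gradient_mem_normalVectors g F q) (fun q hq ↦ hLS _ q hq.1)
      (fun q hq ↦ hLS _ q hq.1) (F p, p) ⟨rfl, hpV⟩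
    have hS := secondFundamentalForm_mongeHypersurface g F (q := (F p, p)) (ξ := ξ) rfl
      ((hL (hv p hpV)).mdifferentiableAt (by simp)) ((hL (hw p hpV)).mdifferentiableAt (by simp))
      (hLS _ _ rfl) (.of_forall fun q hq ↦ hLS _ q hq) (gradient_mem_normalVectors g F _)
      rfl rfl rfl
    rw [hB] at hS
    -- The `∂₀`-coefficient of `ξ` is `1`, so the vanishing of `B_ξ` is exactly the vanishing of the
    -- Hessian on `v`, `w`.
    simpa using hS.symm
  · intro h U ξ X Y hU _ hX hY hξS hXS hYS q hq
    have hUq := hU.mem_nhds hq.2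
    obtain ⟨a, u, hξq⟩ := exists_prodTangent (ξ q)
    obtain ⟨b, v, hXq⟩ := exists_prodTangent (X q)
    obtain ⟨c, w, hYq⟩ := exists_prodTangent (Y q)
    -- Since `U` is a neighbourhood of `q`, tangency of `Y` along the hypersurface within `U` gives
    -- the tangency near `q` that the formula requires.
    rw [secondFundamentalForm_mongeHypersurface g F hq.1
      ((hX.contMDiffAt hUq).mdifferentiableAt (by simp))
      ((hY.contMDiffAt hUq).mdifferentiableAt (by simp)) (hXS q hq)
      (Filter.mem_of_superset hUq fun y hy hyS ↦ hYS y ⟨hyS, hy⟩) (hξS q hq) hξq hXq hYq, h]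
    simp
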